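/- Let $n\ge 1$, let $\gamma:\mathbb R^n\to\mathbb R$ be measurable with $0<\underline\gamma\le\gamma(x)\le\overline\gamma<\infty$ for a.e. $x\in\mathbb R^n$ and some constants $\underline\gamma,\overline\gamma$. For $s\in(0,1)$ put $$\mathcal C_{n,s}=\frac{4^s\,\Gamma(n/2+s)}{\pi^{n/2}\,|\Gamma(-s)|},\qquad \nabla^s u(x,y)=-\frac{\mathcal C_{n,s}^{1/2}}{\sqrt2}\,\frac{u(y)-u(x)}{|y-x|^{n/2+s+1}}\,(y-x),$$ $$\Theta(x,y)=\gamma(x)^{1/2}\gamma(y)^{1/2}\,\mathrm{Id},\qquad B^s_\gamma[u,v]=\int_{\mathbb R^n}\int_{\mathbb R^n}\nabla^s v\cdot(\Theta\cdot\nabla^s u)\,dy\,dx.$$ Let $u,v\in H^1(\mathbb R^n)$ be real-valued, with weak gradients $\nabla u,\nabla v$. Then $\nabla^s v\cdot(\Theta\cdot\nabla^s u)$ is integrable on $\mathbb R^{2n}$ for every $s\in(0,1)$, $\gamma\,\nabla u\cdot\nabla v$ is integrable on $\mathbb R^n$, and $$\lim_{s\to1^-}B^s_\gamma[u,v]=\int_{\mathbb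 R^n}\gamma\,\nabla u\cdot\nabla v\,dx .$$ -/

import Mathlib

open MeasureTheory Filter Topology
open scoped ContDiff

noncomputable section

namespace FracCond

/-- Euclidean space `ℝⁿ`. -/
abbrev Eucl (n : ℕ) : Type := EuclideanSpace ℝ (Fin n)

/-- `G : ℝⁿ → ℝⁿ` is a weak (distributional) gradient of `u : ℝⁿ → ℝ`: for every test function `φ`
and every direction `e`, `∫ u ∂ₑφ = - ∫ φ ⟨G, e⟩`. -/
structure HasWeakGradient {n : ℕ} (u : Eucl n → ℝ) (G : Eucl n → Eucl n) : Prop where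
  locallyIntegrable : LocallyIntegrable u volume
  locallyIntegrable_grad : LocallyIntegrable G volume
  integral_eq : ∀ φ : Eucl n → ℝ, ContDiff ℝ ∞ φ → HasCompactSupport φ → ∀ e : Eucl n,
    ∫ x, u x * fderiv ℝ φ x e = - ∫ x, φ x * inner ℝ (G x) e

/-- The Sobolev space `H¹(ℝⁿ)` of real-valued functions: `u ∈ L²` with a weak gradient in `L²`. -/
def MemH1 {n : ℕ} (u : Eucl n → ℝ) : Prop :=
  MemLp u 2 volume ∧ ∃ G : Eucl n → Eucl n, MemLp G 2 volume ∧ HasWeakGradient u G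

/-- The constant `C_{n,s} = 4^s Γ(n/2 + s) / (π^{n/2} |Γ(-s)|)` of the fractional Laplacian. -/
def fracConst (n : ℕ) (s : ℝ) : ℝ :=
  (4 : ℝ) ^ s * Real.Gamma ((n : ℝ) / 2 + s) /
    (Real.pi ^ ((n : ℝ) / 2) * |Real.Gamma (-s)|)

/-- The fractional gradient
`∇ˢu(x,y) = - (C_{n,s}^{1/2} / √2) (u(y) - u(x)) / |y - x|^{n/2 + s + 1} (y - x)`.
It is linear in `u` and its `L²(ℝ²ⁿ)` norm is controlled by the `Hˢ` norm of `u`; so the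
continuous extension of `∇ˢ` from test functions to `Hˢ(ℝⁿ)` is given by the same formula, for
almost every `(x, y)`. On the (null) diagonal the value is `0`. -/
def fracGradient {n : ℕ} (s : ℝ) (u : Eucl n → ℝ) (x y : Eucl n) : Eucl n :=
  (-(Real.sqrt (fracConst n s) / Real.sqrt 2) *
    ((u y - u x) / ‖y - x‖ ^ ((n : ℝ) / 2 + s + 1))) • (y - x)

/-- The interaction matrix `Θ(x,y) = γ(x)^{1/2} γ(y)^{1/2} Id`, as a linear map of `ℝⁿ`. -/
def interaction {n : ℕ} (γ : Eucl n → ℝ) (x y : Eucl n) : Eucl n →L[ℝ] Eucl n :=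
  (Real.sqrt (γ x) * Real.sqrt (γ y)) • ContinuousLinearMap.id ℝ (Eucl n)

/-- The integrand `∇ˢv · (Θ · ∇ˢu)` of the bilinear form. -/
def bilinIntegrand {n : ℕ} (s : ℝ) (γ u v : Eucl n → ℝ) (x y : Eucl n) : ℝ :=
  inner ℝ (fracGradient s v x y) (interaction γ x y (fracGradient s u x y))

/-- The bilinear form `Bˢ_γ[u,v] = ∫ ∫ ∇ˢv · (Θ · ∇ˢu) dy dx`. -/
def bilin {n : ℕ} (s : ℝ) (γ u v : Eucl n → ℝ) : ℝ :=
  ∫ x, ∫ y, bilinIntegrand s γ u v x y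

end FracCond

end

/- Write `τ_h u = u (· + h)`. For `u ∈ H¹` the map `h ↦ τ_h u ∈ L²` is differentiable at `0` with
derivative `h ↦ ⟪∇u, h⟫`, so the inner integral of `B^s_γ[u,v]` along `y = x + h` is
`⟪√γ ∇u · h, √γ ∇v · h⟫ + o(‖h‖²)`. It is integrated against the kernels
`(C_{n,s} / 2) ‖h‖^(-n-2s)`, which as `s → 1⁻` lose their mass away from the origin. Near the origin
their second moments tend to `n` and, the kernels being radial, a quadratic form integrates to its
trace times the `n`-th part of the second moment; here the trace is `∫ γ ∇u · ∇v`. -/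

noncomputable section

namespace FracCond

open scoped ENNReal

section Translation

variable {E F : Type*} [NormedAddCommGroup E] [InnerProductSpace ℝ E] [FiniteDimensional ℝ E]
  [MeasurableSpace E] [BorelSpace E] [NormedAddCommGroup F] [NormedSpace ℝ F]
  {p : ℝ≥0∞} [Fact (1 ≤ p)]

/-- The translation operator `f ↦ f (· + h)` on `Lᵖ`. -/
def translate (h : E) : Lp F p (volume : Measure E) →ₗᵢ[ℝ] Lp F p (volume : Measure E) :=
  Lp.compMeasurePreservingₗᵢ ℝ (· + h) (measurePreserving_add_right volume h)

theorem coeFn_translate (h : E) (f : Lp F p (volume : Measure E)) :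
    translate h f =ᵐ[volume] fun x => f (x + h) :=
  Lp.coeFn_compMeasurePreserving f (measurePreserving_add_right volume h)

theorem translate_zero (f : Lp F p (volume : Measure E)) : translate 0 f = f := by
  refine Lp.ext ((coeFn_translate 0 f).trans ?_)
  simp only [add_zero]
  rfl

theorem continuous_translate (hp : p ≠ ⊤) (f : Lp F p (volume : Measure E)) :
    Continuous fun h => translate h f := by
  have hcont : Continuous fun h : E => (⟨(· + h), by fun_prop⟩ : C(E, E)) :=
    ContinuousMap.continuous_of_continuous_uncurry _
      (show Continuous fun q : E × E => q.2 + q.1 by fun_prop)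
  exact continuous_const.compMeasurePreservingLp hcont
    (fun h => measurePreserving_add_right volume h) hp

theorem tendsto_translate (hp : p ≠ ⊤) (f : Lp F p (volume : Measure E)) :
    Tendsto (fun h => translate h f) (𝓝 0) (𝓝 f) := by
  simpa only [translate_zero] using (continuous_translate hp f).tendsto 0

theorem translate_smul (h : E) (a : Lp ℝ ⊤ (volume : Measure E))
    (f : Lp F p (volume : Measure E)) :
    translate h (a • f : Lp F p volume) = (translate h a • translate h f : Lp F p volume) := by
  refine Lp.ext ?_
  have hq := (measurePreserving_add_right (volume : Measure E) h).quasiMeasurePreserving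
  filter_upwards [coeFn_translate h (a • f : Lp F p volume),
    hq.ae (Lp.coeFn_lpSMul (r := p) a f), coeFn_translate h a, coeFn_translate h f,
    Lp.coeFn_lpSMul (r := p) (translate h a) (translate h f)] with x h₁ h₂ h₃ h₄ h₅
  rw [h₁, h₂, h₅, Pi.smul_apply', Pi.smul_apply', h₃, h₄]

-- Translation is not norm continuous on `L^∞`, only strongly continuous as an action on `Lᵖ`.
theorem tendsto_translate_smul (hp : p ≠ ⊤) (a : Lp ℝ ⊤ (volume : Measure E))
    (f : Lp F p (volume : Measure E)) :
    Tendsto (fun h => (translate h a • f : Lp F p volume)) (𝓝 0)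
      (𝓝 (a • f : Lp F p volume)) := by
  have hsplit : ∀ h : E, (translate h a • f : Lp F p volume) =
      translate h (a • f : Lp F p volume) +
        (translate h a • (f - translate h f) : Lp F p volume) := by
    intro h
    rw [translate_smul, ← Lp.add_smul, add_sub_cancel]
  have herr : Tendsto (fun h : E => (translate h a • (f - translate h f) : Lp F p volume))
      (𝓝 0) (𝓝 0) := by
    refine squeeze_zero_norm (a := fun h => ‖a‖ * ‖f - translate h f‖)
      (fun h => (Lp.norm_smul_le _ _).trans_eq ?_) ?_
    · rw [LinearIsometry.norm_map]
    · simpa using ((tendsto_translate hp f).const_sub f).norm.const_mul ‖a‖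
  simpa only [hsplit, add_zero] using (tendsto_translate hp (a • f : Lp F p volume)).add herr

end Translation

section WeakDerivative

variable {E H : Type*} [NormedAddCommGroup E] [NormedSpace ℝ E] [NormedAddCommGroup H]
  [InnerProductSpace ℝ H] {s : Set H}

theorem norm_le_of_dense_inner_le (hs : Dense s) {w : H} {C : ℝ} (hC : 0 ≤ C)
    (h : ∀ φ ∈ s, ‖inner ℝ φ w‖ ≤ C * ‖φ‖) : ‖w‖ ≤ C := by
  have hall : ∀ φ : H, ‖inner ℝ φ w‖ ≤ C * ‖φ‖ :=
    hs.induction h (isClosed_le (by fun_prop) (by fun_prop))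
  rcases (norm_nonneg w).eq_or_lt with hw | hw
  · exact hw ▸ hC
  · refine le_of_mul_le_mul_right ?_ hw
    simpa only [real_inner_self_eq_norm_sq, norm_mul, norm_norm, sq] using hall w

theorem hasFDerivAt_of_dense_inner (hs : Dense s) {f : E → H} {f' : E → E →L[ℝ] H} {x : E}
    (hf : ∀ φ ∈ s, ∀ y, HasFDerivAt (fun y => inner ℝ φ (f y)) ((innerSL ℝ φ).comp (f' y)) y)
    (hf' : ContinuousAt f' x) : HasFDerivAt f (f' x) x := by
  rw [hasFDerivAt_iff_isLittleO, Asymptotics.isLittleO_iff]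
  intro ε hε
  obtain ⟨δ, hδ, hball⟩ := Metric.continuousAt_iff.1 hf' ε hε
  filter_upwards [Metric.ball_mem_nhds x hδ] with y hy
  refine norm_le_of_dense_inner_le hs (by positivity) fun φ hφ => ?_
  have hbound : ∀ z ∈ Metric.ball x δ,
      ‖(innerSL ℝ φ).comp (f' z) - (innerSL ℝ φ).comp (f' x)‖ ≤ ‖φ‖ * ε := by
    intro z hz
    rw [← ContinuousLinearMap.comp_sub, ← innerSL_apply_norm ℝ φ]
    refine (ContinuousLinearMap.opNorm_comp_le _ _).trans ?_
    gcongr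
    simpa only [dist_eq_norm] using (hball hz).le
  have hmv := (convex_ball x δ).norm_image_sub_le_of_norm_hasFDerivWithin_le'
    (fun z _ => (hf φ hφ z).hasFDerivWithinAt) hbound (Metric.mem_ball_self hδ) hy
  calc ‖inner ℝ φ (f y - f x - f' x (y - x))‖
      = ‖inner ℝ φ (f y) - inner ℝ φ (f x) - (innerSL ℝ φ).comp (f' x) (y - x)‖ := by
        simp only [inner_sub_right, ContinuousLinearMap.comp_apply, innerSL_apply_apply]
    _ ≤ ‖φ‖ * ε * ‖y - x‖ := hmv
    _ = ε * ‖y - x‖ * ‖φ‖ := by ring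

end WeakDerivative

section Directional

variable {E : Type*} [NormedAddCommGroup E] [InnerProductSpace ℝ E]
  [FiniteDimensional ℝ E] [MeasurableSpace E] [BorelSpace E] {p : ℝ≥0∞} [Fact (1 ≤ p)]

/-- The operator sending a vector field `G ∈ Lᵖ` to the linear map `h ↦ ⟪h, G⟫` from directions to
the corresponding components of `G`. -/
def directional : Lp E p (volume : Measure E) →L[ℝ] E →L[ℝ] Lp ℝ p (volume : Measure E) :=
  ((innerSL ℝ).compLpL₂ p volume).flip

theorem coeFn_directional (G : Lp E p (volume : Measure E)) (h : E) :
    directional G h =ᵐ[volume] fun x => inner ℝ (G x) h := by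
  simp only [real_inner_comm h]
  exact (innerSL ℝ h).coeFn_compLp G

theorem smul_directional (a : Lp ℝ ⊤ (volume : Measure E)) (G : Lp E p (volume : Measure E))
    (h : E) : (a • directional G h : Lp ℝ p volume) = directional (a • G : Lp E p volume) h := by
  refine Lp.ext ?_
  filter_upwards [Lp.coeFn_lpSMul (r := p) a (directional G h), coeFn_directional G h,
    coeFn_directional (a • G : Lp E p volume) h, Lp.coeFn_lpSMul (r := p) a G] with x h₁ h₂ h₃ h₄
  rw [h₁, h₃, h₄, Pi.smul_apply', Pi.smul_apply', h₂, real_inner_smul_left, smul_eq_mul]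

theorem sum_inner_directional {ι : Type*} [Fintype ι] (b : OrthonormalBasis ι ℝ E)
    (G H : Lp E 2 (volume : Measure E)) :
    ∑ i, inner ℝ (directional G (b i)) (directional H (b i)) = inner ℝ G H := by
  simp only [L2.inner_def]
  rw [← integral_finsetSum _ fun i _ => L2.integrable_inner _ _]
  refine integral_congr_ae ?_
  have hG := eventually_all.2 fun i => coeFn_directional G (b i)
  have hH := eventually_all.2 fun i => coeFn_directional H (b i)
  filter_upwards [hG, hH] with x hGx hHx
  simp only [hGx, hHx]
  rw [← b.sum_inner_mul_inner (G x) (H x)]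
  refine Finset.sum_congr rfl fun i _ => ?_
  rw [RCLike.inner_apply, conj_trivial, mul_comm, real_inner_comm (b i) (H x)]

end Directional

section WeakGradient

variable {n : ℕ}

open scoped Convolution

theorem inner_translate_eq_convolution {u φ : Lp ℝ 2 (volume : Measure (Eucl n))}
    {g : Eucl n → ℝ} (hφ : φ =ᵐ[volume] g) :
    (fun h => inner ℝ φ (translate h u)) =
      (u : Eucl n → ℝ) ⋆[ContinuousLinearMap.mul ℝ ℝ, volume] fun x => g (-x) := by
  ext h
  rw [L2.inner_def, convolution_def, ← integral_add_right_eq_self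
    (fun t => ContinuousLinearMap.mul ℝ ℝ (u t) (g (-(h - t)))) h]
  refine integral_congr_ae ?_
  filter_upwards [hφ, coeFn_translate h u] with x hx hux
  rw [hx, hux, RCLike.inner_apply, conj_trivial, ContinuousLinearMap.mul_apply', neg_sub,
    add_sub_cancel_right]

theorem HasWeakGradient.hasFDerivAt_inner_translate {u : Lp ℝ 2 (volume : Measure (Eucl n))}
    {G : Lp (Eucl n) 2 (volume : Measure (Eucl n))} (hw : HasWeakGradient u G)
    {φ : Lp ℝ 2 (volume : Measure (Eucl n))} {g : Eucl n → ℝ} (hφ : φ =ᵐ[volume] g)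
    (hgc : HasCompactSupport g) (hg : ContDiff ℝ ∞ g) (h : Eucl n) :
    HasFDerivAt (fun h => inner ℝ φ (translate h u))
      ((innerSL ℝ φ).comp (directional (translate h G))) h := by
  have hgn : ContDiff ℝ ∞ fun x => g (-x) := hg.comp contDiff_neg
  have hgnc : HasCompactSupport fun x => g (-x) := hgc.comp_homeomorph (Homeomorph.neg _)
  have hderiv := hgnc.hasFDerivAt_convolution_right (ContinuousLinearMap.mul ℝ ℝ)
    hw.locallyIntegrable (hgn.of_le (by simp)) h
  rw [← inner_translate_eq_convolution hφ] at hderiv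
  refine hderiv.congr_fderiv (ContinuousLinearMap.ext fun k => ?_)
  rw [convolution_precompR_apply _ hw.locallyIntegrable (hgnc.fderiv ℝ)
    (hgn.continuous_fderiv (by simp)), convolution_def]
  have hweak := hw.integral_eq (fun x => g (x + -h)) (hg.comp (by fun_prop))
    (hgc.comp_homeomorph (Homeomorph.addRight (-h))) k
  have hneg : ∀ x, fderiv ℝ (fun y => g (-y)) x = -fderiv ℝ g (-x) := fun x => by
    simpa using fderiv_comp_smul (𝕜 := ℝ) (f := g) (x := x) (-1)
  symm
  calc inner ℝ φ (directional (translate h G) k)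
      = ∫ x, g x * inner ℝ (G (x + h)) k := by
        rw [L2.inner_def]
        refine integral_congr_ae ?_
        filter_upwards [hφ, coeFn_directional (translate h G) k, coeFn_translate h G]
          with x h₁ h₂ h₃
        rw [h₁, h₂, h₃, RCLike.inner_apply, conj_trivial, mul_comm]
    _ = ∫ x, g (x + -h) * inner ℝ (G x) k := by
        rw [← integral_add_right_eq_self (fun x => g (x + -h) * inner ℝ (G x) k) h]
        simp only [add_neg_cancel_right]
    _ = ∫ x, ContinuousLinearMap.mul ℝ ℝ (u x) (fderiv ℝ (fun y => g (-y)) (h - x) k) := by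
        rw [← neg_eq_iff_eq_neg.2 hweak, ← integral_neg]
        simp [hneg, fderiv_comp_add_right, sub_eq_add_neg]

theorem HasWeakGradient.hasFDerivAt_translate {u : Lp ℝ 2 (volume : Measure (Eucl n))}
    {G : Lp (Eucl n) 2 (volume : Measure (Eucl n))} (hw : HasWeakGradient u G) :
    HasFDerivAt (fun h => translate h u) (directional G) 0 := by
  have hcont : Continuous fun h => directional (translate h G) :=
    directional.continuous.comp (continuous_translate ENNReal.ofNat_ne_top G)
  have hdense := MeasureTheory.Lp.dense_hasCompactSupport_contDiff (F := ℝ)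
    (μ := (volume : Measure (Eucl n))) (p := 2) ENNReal.ofNat_ne_top
  have hderiv := hasFDerivAt_of_dense_inner hdense
    (f' := fun h => directional (translate h G)) (f := fun h => translate h u)
    (fun φ ⟨g, hφ, hgc, hg⟩ h => hw.hasFDerivAt_inner_translate hφ hgc hg h) (x := 0)
    hcont.continuousAt
  rwa [translate_zero] at hderiv

end WeakGradient

section SecondOrder

open Asymptotics

theorem isLittleO_sub_fderiv_of_map_zero {E F : Type*} [NormedAddCommGroup E] [NormedSpace ℝ E]
    [NormedAddCommGroup F] [NormedSpace ℝ F] {P : E → F} {P' : E →L[ℝ] F}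
    (hP : HasFDerivAt P P' 0) (hP₀ : P 0 = 0) : (fun h => P h - P' h) =o[𝓝 0] fun h => h := by
  simpa only [zero_add, hP₀, sub_zero] using hasFDerivAt_iff_isLittleO_nhds_zero.1 hP

theorem isLittleO_inner_sub_inner_fderiv {E H : Type*} [NormedAddCommGroup E] [NormedSpace ℝ E]
    [NormedAddCommGroup H] [InnerProductSpace ℝ H] {P R : E → H} {P' R' : E →L[ℝ] H}
    (hP : HasFDerivAt P P' 0) (hP₀ : P 0 = 0) (hR : HasFDerivAt R R' 0) (hR₀ : R 0 = 0) :
    (fun h => inner ℝ (P h) (R h) - inner ℝ (P' h) (R' h)) =o[𝓝 0] fun h => ‖h‖ ^ 2 := by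
  have hPo := (isLittleO_sub_fderiv_of_map_zero hP hP₀).norm_norm
  have hRo := (isLittleO_sub_fderiv_of_map_zero hR hR₀).norm_norm
  have hRO : (fun h => ‖R h‖) =O[𝓝 0] fun h => ‖h‖ := by
    simpa only [hR₀, sub_zero] using hR.isBigO_sub.norm_norm
  have hPO : (fun h => ‖P' h‖) =O[𝓝 0] fun h => ‖h‖ := (P'.isBigO_id _).norm_norm
  refine IsBigO.trans_isLittleO (g := fun h => ‖P h - P' h‖ * ‖R h‖ + ‖P' h‖ * ‖R h - R' h‖)
    (IsBigO.of_norm_le fun h => ?_) ?_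
  · have hsplit : inner ℝ (P h) (R h) - inner ℝ (P' h) (R' h) =
        inner ℝ (P h - P' h) (R h) + inner ℝ (P' h) (R h - R' h) := by
      rw [inner_sub_left, inner_sub_right, sub_add_sub_cancel]
    rw [hsplit]
    exact (norm_add_le _ _).trans (add_le_add (norm_inner_le_norm _ _) (norm_inner_le_norm _ _))
  · simpa only [sq] using (hPo.mul_isBigO hRO).add (hPO.mul_isLittleO hRo)

variable {E : Type*} [NormedAddCommGroup E] [InnerProductSpace ℝ E] [FiniteDimensional ℝ E]
  [MeasurableSpace E] [BorelSpace E] {p : ℝ≥0∞} [Fact (1 ≤ p)]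

theorem hasFDerivAt_smul_of_tendsto {D : E → Lp ℝ p (volume : Measure E)}
    {G : Lp E p (volume : Measure E)} (hD : HasFDerivAt D (directional G) 0) (hD₀ : D 0 = 0)
    {A : E → Lp ℝ ⊤ (volume : Measure E)} {a : Lp ℝ ⊤ (volume : Measure E)} {C : ℝ}
    (hA : ∀ h, ‖A h‖ ≤ C)
    (hAG : Tendsto (fun h => (A h • G : Lp E p volume)) (𝓝 0) (𝓝 (a • G : Lp E p volume))) :
    HasFDerivAt (fun h => (A h • D h : Lp ℝ p volume)) (directional (a • G : Lp E p volume)) 0 := by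
  rw [hasFDerivAt_iff_isLittleO_nhds_zero]
  have hsplit : ∀ h, (A h • D h : Lp ℝ p volume) - directional (a • G : Lp E p volume) h =
      (A h • (D h - directional G h) : Lp ℝ p volume) +
        directional ((A h • G : Lp E p volume) - (a • G : Lp E p volume)) h := by
    intro h
    rw [sub_eq_add_neg (D h), Lp.add_smul, Lp.smul_neg, smul_directional, map_sub, sub_apply]
    abel
  simp only [zero_add, hD₀, Lp.smul_zero, sub_zero, hsplit]
  refine IsLittleO.add (IsBigO.trans_isLittleO (IsBigO.of_bound C (.of_forall fun h => ?_))
    (isLittleO_sub_fderiv_of_map_zero hD hD₀)) ?_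
  · exact (Lp.norm_smul_le _ _).trans (by gcongr; exact hA h)
  · have hzero : Tendsto (fun h => ‖directional ((A h • G : Lp E p volume) - a • G)‖)
        (𝓝 0) (𝓝 0) := by
      simpa only [map_zero, norm_zero, Function.comp_def] using
        ((directional.continuous.tendsto _).comp (tendsto_sub_nhds_zero_iff.2 hAG)).norm
    have hmul := ((isLittleO_one_iff ℝ).2 hzero).mul_isBigO (isBigO_refl (fun h : E => ‖h‖) (𝓝 0))
    simp only [one_mul] at hmul
    exact (IsBigO.of_norm_le fun h => ContinuousLinearMap.le_opNorm _ h).trans_isLittleO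
      hmul.of_norm_right

end SecondOrder

section Isotropy

variable {E : Type*} [NormedAddCommGroup E] [InnerProductSpace ℝ E] [FiniteDimensional ℝ E]
  [MeasurableSpace E] [BorelSpace E]

theorem integral_radial_mul_comp_isometry (w : ℝ → ℝ) (f : E → ℝ) (R : E ≃ₗᵢ[ℝ] E) :
    ∫ h, w ‖h‖ * f (R h) = ∫ h, w ‖h‖ * f h := by
  rw [← R.measurePreserving.integral_comp R.toHomeomorph.measurableEmbedding
    (fun h => w ‖h‖ * f h)]
  simp only [LinearIsometryEquiv.norm_map]

theorem integral_radial_mul_inner_mul_inner_eq_zero (w : ℝ → ℝ) {x y : E}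
    (hxy : inner ℝ x y = 0) : ∫ h, w ‖h‖ * (inner ℝ x h * inner ℝ y h) = 0 := by
  let R := (ℝ ∙ x)ᗮ.reflection
  have hx : ∀ h, inner ℝ x (R h) = -inner ℝ x h := fun h => by
    rw [← R.inner_map_map, Submodule.reflection_reflection,
      Submodule.reflection_orthogonalComplement_singleton_eq_neg, inner_neg_left]
  have hy : ∀ h, inner ℝ y (R h) = inner ℝ y h := fun h => by
    rw [← R.inner_map_map, Submodule.reflection_reflection,
      Submodule.reflection_mem_subspace_eq_self
        (Submodule.mem_orthogonal_singleton_iff_inner_right.2 hxy)]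
  have hodd := integral_radial_mul_comp_isometry w (fun h => inner ℝ x h * inner ℝ y h) R
  simp only [hx, hy, neg_mul, mul_neg, integral_neg] at hodd
  linarith

theorem integral_radial_mul_inner_sq_eq_of_norm_eq (w : ℝ → ℝ) {x y : E} (hxy : ‖x‖ = ‖y‖) :
    ∫ h, w ‖h‖ * inner ℝ x h ^ 2 = ∫ h, w ‖h‖ * inner ℝ y h ^ 2 := by
  let R := (ℝ ∙ (x - y))ᗮ.reflection
  have hx : ∀ h, inner ℝ x (R h) = inner ℝ y h := fun h => by
    rw [← R.inner_map_map, Submodule.reflection_reflection, Submodule.reflection_sub hxy]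
  rw [← integral_radial_mul_comp_isometry w (fun h => inner ℝ x h ^ 2) R]
  simp only [hx]

theorem integrable_radial_mul_bilin {w : ℝ → ℝ} (hw : Integrable fun h : E => w ‖h‖ * ‖h‖ ^ 2)
    (B : E →L[ℝ] E →L[ℝ] ℝ) : Integrable fun h => w ‖h‖ * B h h := by
  have hbdd : ∀ h : E, ‖B h h / ‖h‖ ^ 2‖ ≤ ‖B‖ := fun h => by
    rw [norm_div, norm_pow, norm_norm]
    exact div_le_of_le_mul₀ (by positivity) (by positivity) (by
      simpa only [sq, mul_assoc] using B.le_opNorm₂ h h)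
  have hmeas : Measurable fun h : E => B h h / ‖h‖ ^ 2 := by
    have : Continuous fun h : E => B h h := by fun_prop
    exact this.measurable.div (by fun_prop)
  refine (hw.mul_bdd hmeas.aestronglyMeasurable (.of_forall hbdd)).congr (.of_forall fun h => ?_)
  rcases eq_or_ne h 0 with rfl | hh
  · simp
  · have := norm_ne_zero_iff.2 hh
    field_simp

theorem integrable_radial_mul_inner_mul {w : ℝ → ℝ}
    (hw : Integrable fun h : E => w ‖h‖ * ‖h‖ ^ 2) (x : E) (L : E →L[ℝ] ℝ) :
    Integrable fun h => w ‖h‖ * (inner ℝ x h * L h) := by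
  simpa using integrable_radial_mul_bilin hw
    ((ContinuousLinearMap.mul ℝ ℝ).bilinearComp (innerSL ℝ x) L)

theorem finrank_mul_integral_radial_mul_inner_sq {w : ℝ → ℝ}
    (hw : Integrable fun h : E => w ‖h‖ * ‖h‖ ^ 2) {x : E} (hx : ‖x‖ = 1) :
    Module.finrank ℝ E * ∫ h, w ‖h‖ * inner ℝ x h ^ 2 = ∫ h : E, w ‖h‖ * ‖h‖ ^ 2 := by
  let b := stdOrthonormalBasis ℝ E
  have hint : ∀ i, Integrable fun h => w ‖h‖ * inner ℝ (b i) h ^ 2 := fun i => by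
    simpa only [sq, innerSL_apply_apply] using
      integrable_radial_mul_inner_mul hw (b i) (innerSL ℝ (b i))
  have hconst : ∀ i, ∫ h, w ‖h‖ * inner ℝ (b i) h ^ 2 = ∫ h, w ‖h‖ * inner ℝ x h ^ 2 := fun i =>
    integral_radial_mul_inner_sq_eq_of_norm_eq w ((b.norm_eq_one i).trans hx.symm)
  simp only [← b.sum_sq_inner_right, Finset.mul_sum, integral_finsetSum _ fun i _ => hint i, hconst,
    Finset.sum_const, Finset.card_univ, Fintype.card_fin, nsmul_eq_mul]

theorem finrank_mul_integral_radial_mul_inner_mul {w : ℝ → ℝ}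
    (hw : Integrable fun h : E => w ‖h‖ * ‖h‖ ^ 2) {x : E} (hx : ‖x‖ = 1) (L : E →L[ℝ] ℝ) :
    Module.finrank ℝ E * ∫ h, w ‖h‖ * (inner ℝ x h * L h) =
      (∫ h : E, w ‖h‖ * ‖h‖ ^ 2) * L x := by
  let y := (InnerProductSpace.toDual ℝ E).symm L - L x • x
  have hL : ∀ h, L h = L x * inner ℝ x h + inner ℝ y h := fun h => by
    simp [y, inner_sub_left, real_inner_smul_left]
  have hxy : inner ℝ x y = 0 := by
    rw [real_inner_comm]
    simp [y, inner_sub_left, real_inner_smul_left, hx]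
  have hsplit : ∀ h, w ‖h‖ * (inner ℝ x h * L h) =
      L x * (w ‖h‖ * inner ℝ x h ^ 2) + w ‖h‖ * (inner ℝ x h * inner ℝ y h) := fun h => by
    rw [hL h]
    ring
  have horth : Integrable fun h => w ‖h‖ * (inner ℝ x h * inner ℝ y h) :=
    integrable_radial_mul_inner_mul hw x (innerSL ℝ y)
  have hpar : Integrable fun h => L x * (w ‖h‖ * inner ℝ x h ^ 2) := by
    simpa only [sq, innerSL_apply_apply] using
      (integrable_radial_mul_inner_mul hw x (innerSL ℝ x)).const_mul (L x)
  rw [integral_congr_ae (.of_forall hsplit), integral_add hpar horth,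
    integral_const_mul, integral_radial_mul_inner_mul_inner_eq_zero w hxy,
    ← finrank_mul_integral_radial_mul_inner_sq hw hx]
  ring

theorem finrank_mul_integral_radial_mul_bilin {w : ℝ → ℝ}
    (hw : Integrable fun h : E => w ‖h‖ * ‖h‖ ^ 2) (B : E →L[ℝ] E →L[ℝ] ℝ)
    {ι : Type*} [Fintype ι] (b : OrthonormalBasis ι ℝ E) :
    Module.finrank ℝ E * ∫ h, w ‖h‖ * B h h = (∫ h : E, w ‖h‖ * ‖h‖ ^ 2) * ∑ i, B (b i) (b i) := by
  have hexp : ∀ h, w ‖h‖ * B h h = ∑ i, w ‖h‖ * (inner ℝ (b i) h * B (b i) h) := by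
    intro h
    have hB : B h = ∑ i, inner ℝ (b i) h • B (b i) := by
      simpa only [map_sum, map_smul] using congrArg B (b.sum_repr' h).symm
    conv_lhs => rw [hB, sum_apply, Finset.mul_sum]
    rfl
  rw [integral_congr_ae (.of_forall hexp),
    integral_finsetSum _ fun i _ => integrable_radial_mul_inner_mul hw (b i) (B (b i)),
    Finset.mul_sum, Finset.mul_sum]
  exact Finset.sum_congr rfl fun i _ =>
    finrank_mul_integral_radial_mul_inner_mul hw (b.norm_eq_one i) (B (b i))

end Isotropy

section Concentration

open Asymptotics Metric

theorem exists_ball_abs_le_of_isBigOWith {E : Type*} [NormedAddCommGroup E] {F : E → ℝ} {ε : ℝ}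
    (hF : IsBigOWith ε (𝓝 0) F fun h => ‖h‖ ^ 2) :
    ∃ δ, 0 < δ ∧ δ ≤ 1 ∧ ∀ h ∈ ball (0 : E) δ, |F h| ≤ ε * ‖h‖ ^ 2 := by
  obtain ⟨δ, hδ, hball⟩ := eventually_nhds_iff_ball.1 hF.bound
  refine ⟨min δ 1, by positivity, min_le_right _ _, fun h hh => ?_⟩
  simpa using hball h (ball_subset_ball (min_le_left _ _) hh)

theorem indicator_Iio_norm_mul {E : Type*} [NormedAddCommGroup E] (k : ℝ → ℝ) (r : ℝ) (f : E → ℝ)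
    (h : E) : (Set.Iio r).indicator k ‖h‖ * f h =
      (ball 0 r).indicator (fun h => k ‖h‖ * f h) h := by
  by_cases hh : ‖h‖ < r <;> simp [hh]

variable {E : Type*} [NormedAddCommGroup E] [InnerProductSpace ℝ E] [FiniteDimensional ℝ E]
  [MeasurableSpace E] [BorelSpace E]

variable (E) in
/-- The radial kernel `h ↦ k ‖h‖` is the density of a Lévy measure on `E`: it is nonnegative,
integrates `‖h‖²` near the origin and is integrable away from it. -/
structure IsLevyKernel (k : ℝ → ℝ) : Prop where
  measurable : Measurable k
  nonneg : ∀ r, 0 ≤ r → 0 ≤ k r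
  integrableOn_ball : IntegrableOn (fun h : E => k ‖h‖ * ‖h‖ ^ 2) (ball 0 1)
  integrableOn_compl_ball : ∀ δ, 0 < δ → IntegrableOn (fun h : E => k ‖h‖) (ball 0 δ)ᶜ

variable (E) in
/-- A family of radial Lévy kernels concentrates at the origin of `E` if its mass away from the
origin vanishes in the limit, while its second moment near the origin is normalized so that every
coordinate direction contributes `1`. -/
structure IsConcentrating {ι : Type*} (l : Filter ι) (k : ι → ℝ → ℝ) : Prop where
  eventually_isLevyKernel : ∀ᶠ i in l, IsLevyKernel E (k i)
  tendsto_ball : Tendsto (fun i => ∫ h in ball (0 : E) 1, k i ‖h‖ * ‖h‖ ^ 2) l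
    (𝓝 (Module.finrank ℝ E))
  tendsto_compl_ball : ∀ δ, 0 < δ → Tendsto (fun i => ∫ h in (ball (0 : E) δ)ᶜ, k i ‖h‖) l (𝓝 0)

/-- The dominating function used to integrate against a radial kernel: `ε ‖h‖²` on the unit ball
and `C` off the ball of radius `δ`. -/
def splitBound (k : ℝ → ℝ) (ε C δ : ℝ) (h : E) : ℝ :=
  (ball 0 1).indicator (fun h => ε * (k ‖h‖ * ‖h‖ ^ 2)) h +
    (ball 0 δ)ᶜ.indicator (fun h => C * k ‖h‖) h

variable {k : ℝ → ℝ} {ε C δ : ℝ}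

namespace IsLevyKernel

theorem integrable_indicator_ball (hk : IsLevyKernel E k) (ε : ℝ) :
    Integrable ((ball (0 : E) 1).indicator fun h => ε * (k ‖h‖ * ‖h‖ ^ 2)) :=
  (integrable_indicator_iff measurableSet_ball).2 (Integrable.const_mul hk.integrableOn_ball ε)

theorem integrable_indicator_compl_ball (hk : IsLevyKernel E k) (C : ℝ) (hδ : 0 < δ) :
    Integrable ((ball (0 : E) δ)ᶜ.indicator fun h => C * k ‖h‖) :=
  (integrable_indicator_iff measurableSet_ball.compl).2
    (Integrable.const_mul (hk.integrableOn_compl_ball δ hδ) C)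

theorem integrable_splitBound (hk : IsLevyKernel E k) (hδ : 0 < δ) :
    Integrable (splitBound (E := E) k ε C δ) :=
  (hk.integrable_indicator_ball ε).add (hk.integrable_indicator_compl_ball C hδ)

theorem integral_splitBound (hk : IsLevyKernel E k) (hδ : 0 < δ) :
    ∫ h, splitBound (E := E) k ε C δ h =
      ε * (∫ h in ball (0 : E) 1, k ‖h‖ * ‖h‖ ^ 2) + C * ∫ h in (ball (0 : E) δ)ᶜ, k ‖h‖ := by
  simp only [splitBound]
  rw [integral_add (hk.integrable_indicator_ball ε) (hk.integrable_indicator_compl_ball C hδ),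
    integral_indicator measurableSet_ball, integral_indicator measurableSet_ball.compl,
    integral_const_mul, integral_const_mul]

theorem norm_mul_le_splitBound (hk : IsLevyKernel E k) (hδ : δ ≤ 1) (hε : 0 ≤ ε) {F : E → ℝ}
    (hF : ∀ h, |F h| ≤ C) (hFδ : ∀ h ∈ ball (0 : E) δ, |F h| ≤ ε * ‖h‖ ^ 2) (h : E) :
    ‖k ‖h‖ * F h‖ ≤ splitBound k ε C δ h := by
  have hk₀ : ∀ h : E, 0 ≤ k ‖h‖ := fun h => hk.nonneg ‖h‖ (norm_nonneg h)
  rw [norm_mul, Real.norm_of_nonneg (hk₀ h), Real.norm_eq_abs, splitBound]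
  by_cases hh : h ∈ ball (0 : E) δ
  · rw [Set.indicator_of_mem (ball_subset_ball hδ hh),
      Set.indicator_of_notMem (Set.notMem_compl_iff.2 hh), add_zero, mul_left_comm]
    exact mul_le_mul_of_nonneg_left (hFδ h hh) (hk₀ h)
  · rw [Set.indicator_of_mem (s := (ball (0 : E) δ)ᶜ) hh, mul_comm]
    exact le_add_of_nonneg_of_le
      (Set.indicator_nonneg (fun h _ => mul_nonneg hε (mul_nonneg (hk₀ h) (sq_nonneg _))) h)
      (mul_le_mul_of_nonneg_right (hF h) (hk₀ h))

theorem integrable_mul (hk : IsLevyKernel E k) {F : E → ℝ}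
    (hFm : AEStronglyMeasurable F) (hFC : ∀ h, |F h| ≤ C)
    (hFO : F =O[𝓝 0] fun h => ‖h‖ ^ 2) : Integrable fun h => k ‖h‖ * F h := by
  obtain ⟨ε, hε, hFε⟩ := hFO.exists_nonneg
  obtain ⟨δ, hδ, hδ₁, hFδ⟩ := exists_ball_abs_le_of_isBigOWith hFε
  exact (hk.integrable_splitBound hδ).mono'
    ((hk.measurable.comp measurable_norm).aestronglyMeasurable.mul hFm)
    (.of_forall (hk.norm_mul_le_splitBound hδ₁ hε hFC hFδ))

theorem integrable_indicator_mul_sq (hk : IsLevyKernel E k) :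
    Integrable fun h : E => (Set.Iio 1).indicator k ‖h‖ * ‖h‖ ^ 2 := by
  simpa only [indicator_Iio_norm_mul k 1 (fun h : E => ‖h‖ ^ 2), one_mul] using
    hk.integrable_indicator_ball (E := E) 1

end IsLevyKernel

namespace IsConcentrating

variable {ι : Type*} {l : Filter ι} {k : ι → ℝ → ℝ}

theorem tendsto_integral_mul_of_isLittleO (hk : IsConcentrating E l k) {F : E → ℝ}
    (hFC : ∀ h, |F h| ≤ C) (hFo : F =o[𝓝 0] fun h => ‖h‖ ^ 2) :
    Tendsto (fun i => ∫ h, k i ‖h‖ * F h) l (𝓝 0) := by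
  rw [Metric.tendsto_nhds]
  intro η hη
  let d : ℝ := Module.finrank ℝ E
  let ε := η / (d + 1)
  have hε : 0 < ε := by positivity
  have hεη : ε * d + C * 0 < η := by
    rw [mul_zero, add_zero, div_mul_eq_mul_div, div_lt_iff₀ (by positivity)]
    linarith
  obtain ⟨δ, hδ, hδ₁, hFδ⟩ := exists_ball_abs_le_of_isBigOWith (hFo.forall_isBigOWith hε)
  have hlim := (hk.tendsto_ball.const_mul ε).add ((hk.tendsto_compl_ball δ hδ).const_mul C)
  filter_upwards [hk.eventually_isLevyKernel, hlim.eventually_lt_const hεη] with i hki hi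
  rw [dist_zero_right]
  calc ‖∫ h, k i ‖h‖ * F h‖ ≤ ∫ h, splitBound (E := E) (k i) ε C δ h :=
        norm_integral_le_of_norm_le (hki.integrable_splitBound hδ)
          (.of_forall (hki.norm_mul_le_splitBound hδ₁ hε.le hFC hFδ))
    _ < η := by rwa [hki.integral_splitBound hδ]

theorem tendsto_integral_indicator_mul_bilin [Nontrivial E] (hk : IsConcentrating E l k)
    (B : E →L[ℝ] E →L[ℝ] ℝ) {κ : Type*} [Fintype κ] (b : OrthonormalBasis κ ℝ E) :
    Tendsto (fun i => ∫ h, (Set.Iio 1).indicator (k i) ‖h‖ * B h h) l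
      (𝓝 (∑ j, B (b j) (b j))) := by
  have hd : (Module.finrank ℝ E : ℝ) ≠ 0 := Nat.cast_ne_zero.2 Module.finrank_pos.ne'
  have hlim := (hk.tendsto_ball.mul_const (∑ j, B (b j) (b j))).div_const (Module.finrank ℝ E : ℝ)
  rw [mul_div_cancel_left₀ _ hd] at hlim
  refine hlim.congr' (hk.eventually_isLevyKernel.mono fun i hi => ?_)
  have hball : ∫ h : E, (Set.Iio 1).indicator (k i) ‖h‖ * ‖h‖ ^ 2 =
      ∫ h in ball (0 : E) 1, k i ‖h‖ * ‖h‖ ^ 2 := by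
    simp only [indicator_Iio_norm_mul (k i) 1 (fun h : E => ‖h‖ ^ 2),
      integral_indicator measurableSet_ball]
  rw [div_eq_iff hd, mul_comm _ (Module.finrank ℝ E : ℝ), ← hball,
    finrank_mul_integral_radial_mul_bilin hi.integrable_indicator_mul_sq B b]

theorem tendsto_integral_mul [Nontrivial E] (hk : IsConcentrating E l k) {g : E → ℝ}
    (hgm : AEStronglyMeasurable g) (hgC : ∀ h, |g h| ≤ C) {B : E →L[ℝ] E →L[ℝ] ℝ}
    (hgB : (fun h => g h - B h h) =o[𝓝 0] fun h => ‖h‖ ^ 2)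
    {κ : Type*} [Fintype κ] (b : OrthonormalBasis κ ℝ E) :
    Tendsto (fun i => ∫ h, k i ‖h‖ * g h) l (𝓝 (∑ j, B (b j) (b j))) := by
  -- `B` is unbounded; truncating it to the unit ball keeps the remainder bounded.
  let F : E → ℝ := fun h => g h - (ball 0 1).indicator (fun h => B h h) h
  have hBm : Measurable fun h : E => B h h := by
    have : Continuous fun h : E => B h h := by fun_prop
    exact this.measurable
  have hFm : AEStronglyMeasurable F :=
    hgm.sub (hBm.indicator measurableSet_ball).aestronglyMeasurable
  have hBC : ∀ h, |(ball (0 : E) 1).indicator (fun h => B h h) h| ≤ ‖B‖ := fun h => by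
    rw [← Real.norm_eq_abs, norm_indicator_eq_indicator_norm]
    refine Set.indicator_apply_le' (fun hh => ?_) fun _ => norm_nonneg B
    have hh₁ : ‖h‖ ≤ 1 := (mem_ball_zero_iff.1 hh).le
    calc ‖B h h‖ ≤ ‖B‖ * ‖h‖ * ‖h‖ := B.le_opNorm₂ h h
      _ ≤ ‖B‖ * 1 * 1 := by gcongr
      _ = ‖B‖ := by ring
  have hFC : ∀ h, |F h| ≤ C + ‖B‖ := fun h => (abs_sub _ _).trans (add_le_add (hgC h) (hBC h))
  have hFo : F =o[𝓝 0] fun h => ‖h‖ ^ 2 := by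
    refine hgB.congr' ?_ .rfl
    filter_upwards [ball_mem_nhds (0 : E) one_pos] with h hh
    simp only [F, Set.indicator_of_mem hh]
  have hlim := (hk.tendsto_integral_mul_of_isLittleO hFC hFo).add
    (hk.tendsto_integral_indicator_mul_bilin B b)
  rw [zero_add] at hlim
  refine hlim.congr' (hk.eventually_isLevyKernel.mono fun i hi => ?_)
  rw [← integral_add (hi.integrable_mul hFm hFC hFo.isBigO)
    (integrable_radial_mul_bilin hi.integrable_indicator_mul_sq B)]
  refine integral_congr_ae (.of_forall fun h => ?_)
  by_cases hh : ‖h‖ < 1 <;> simp [F, hh, mul_sub]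

end IsConcentrating

end Concentration

section Radial

open Metric Module

variable {E : Type*} [NormedAddCommGroup E] [NormedSpace ℝ E] [FiniteDimensional ℝ E]
  [Nontrivial E] [MeasurableSpace E] [BorelSpace E] (μ : Measure E) [μ.IsAddHaarMeasure]

theorem integrableOn_norm_preimage_iff {S : Set ℝ} (hS : MeasurableSet S) (f : ℝ → ℝ) :
    IntegrableOn (fun x : E => f ‖x‖) (norm ⁻¹' S) μ ↔
      IntegrableOn (fun y => y ^ (finrank ℝ E - 1) * f y) (Set.Ioi 0 ∩ S) := by
  have hind : (norm ⁻¹' S).indicator (fun x : E => f ‖x‖) = fun x => S.indicator f ‖x‖ := rfl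
  rw [← integrable_indicator_iff (measurable_norm hS), hind, integrable_fun_norm_addHaar,
    Set.inter_comm]
  simp only [smul_eq_mul, ← Set.indicator_mul_right S fun y : ℝ => y ^ (finrank ℝ E - 1)]
  rw [IntegrableOn, integrable_indicator_iff hS, IntegrableOn, IntegrableOn,
    Measure.restrict_restrict hS]

theorem setIntegral_norm_preimage {S : Set ℝ} (hS : MeasurableSet S) (f : ℝ → ℝ) :
    ∫ x : E in norm ⁻¹' S, f ‖x‖ ∂μ =
      finrank ℝ E * μ.real (ball 0 1) * ∫ y in Set.Ioi 0 ∩ S, y ^ (finrank ℝ E - 1) * f y := by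
  have hind : (norm ⁻¹' S).indicator (fun x : E => f ‖x‖) = fun x => S.indicator f ‖x‖ := rfl
  rw [← integral_indicator (measurable_norm hS), hind, integral_fun_norm_addHaar]
  simp only [smul_eq_mul, nsmul_eq_mul,
    ← Set.indicator_mul_right S fun y : ℝ => y ^ (finrank ℝ E - 1)]
  rw [setIntegral_indicator hS, mul_assoc]

variable {f : ℝ → ℝ} {c q δ : ℝ}

theorem integrableOn_ball_norm_of_rpow (hf : ∀ y, 0 < y → y ^ (finrank ℝ E - 1) * f y = c * y ^ q)
    (hq : -1 < q) (hδ : 0 < δ) : IntegrableOn (fun x : E => f ‖x‖) (ball 0 δ) μ := by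
  have hball : ball (0 : E) δ = norm ⁻¹' Set.Iio δ := by ext; simp
  rw [hball, integrableOn_norm_preimage_iff μ measurableSet_Iio, Set.Ioi_inter_Iio,
    integrableOn_congr_fun (fun y hy => hf y hy.1) measurableSet_Ioo]
  exact ((intervalIntegral.integrableOn_Ioo_rpow_iff hδ).2 hq).const_mul c

theorem setIntegral_ball_norm_of_rpow (hf : ∀ y, 0 < y → y ^ (finrank ℝ E - 1) * f y = c * y ^ q)
    (hq : -1 < q) (hδ : 0 < δ) :
    ∫ x in ball (0 : E) δ, f ‖x‖ ∂μ =
      finrank ℝ E * μ.real (ball 0 1) * (c * (δ ^ (q + 1) / (q + 1))) := by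
  have hball : ball (0 : E) δ = norm ⁻¹' Set.Iio δ := by ext; simp
  rw [hball, setIntegral_norm_preimage μ measurableSet_Iio, Set.Ioi_inter_Iio,
    setIntegral_congr_fun measurableSet_Ioo fun y hy => hf y hy.1, integral_const_mul,
    ← integral_Ioc_eq_integral_Ioo, ← intervalIntegral.integral_of_le hδ.le,
    integral_rpow (.inl hq), Real.zero_rpow (by linarith), sub_zero]

theorem integrableOn_compl_ball_norm_of_rpow
    (hf : ∀ y, 0 < y → y ^ (finrank ℝ E - 1) * f y = c * y ^ q) (hq : q < -1) (hδ : 0 < δ) :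
    IntegrableOn (fun x : E => f ‖x‖) (ball 0 δ)ᶜ μ := by
  have hball : (ball (0 : E) δ)ᶜ = norm ⁻¹' Set.Ici δ := by ext; simp
  rw [hball, integrableOn_norm_preimage_iff μ measurableSet_Ici,
    Set.inter_eq_right.2 (Set.Ici_subset_Ioi.2 hδ),
    integrableOn_Ici_iff_integrableOn_Ioi]
  exact IntegrableOn.congr_fun (Integrable.const_mul (integrableOn_Ioi_rpow_of_lt hq hδ) c)
    (fun y hy => (hf y (hδ.trans hy)).symm) measurableSet_Ioi

theorem setIntegral_compl_ball_norm_of_rpow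
    (hf : ∀ y, 0 < y → y ^ (finrank ℝ E - 1) * f y = c * y ^ q) (hq : q < -1) (hδ : 0 < δ) :
    ∫ x in (ball (0 : E) δ)ᶜ, f ‖x‖ ∂μ =
      finrank ℝ E * μ.real (ball 0 1) * (c * (-δ ^ (q + 1) / (q + 1))) := by
  have hball : (ball (0 : E) δ)ᶜ = norm ⁻¹' Set.Ici δ := by ext; simp
  rw [hball, setIntegral_norm_preimage μ measurableSet_Ici,
    Set.inter_eq_right.2 (Set.Ici_subset_Ioi.2 hδ),
    setIntegral_congr_fun measurableSet_Ici fun y hy => hf y (hδ.trans_le hy),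
    integral_const_mul, integral_Ici_eq_integral_Ioi, integral_Ioi_rpow_of_lt hq hδ]

end Radial

section FracKernel

open Metric

variable {n : ℕ}

theorem fracConst_nonneg {s : ℝ} (hs : 0 < s) : 0 ≤ fracConst n s := by
  have : 0 < Real.Gamma ((n : ℝ) / 2 + s) := Real.Gamma_pos_of_pos (by positivity)
  unfold fracConst
  positivity

theorem fracConst_eq {s : ℝ} (h0 : 0 < s) (h1 : s < 1) :
    fracConst n s = (1 - s) * (s * (4 : ℝ) ^ s * Real.Gamma ((n : ℝ) / 2 + s) /
      (Real.pi ^ ((n : ℝ) / 2) * Real.Gamma (2 - s))) := by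
  have hΓ₁ : Real.Gamma (1 - s) = -s * Real.Gamma (-s) := by
    rw [← Real.Gamma_add_one (by linarith), neg_add_eq_sub]
  have hΓ₂ : Real.Gamma (2 - s) = (1 - s) * Real.Gamma (1 - s) := by
    rw [← Real.Gamma_add_one (by linarith)]
    congr 1
    ring
  have hpos : 0 < Real.Gamma (2 - s) := Real.Gamma_pos_of_pos (by linarith)
  have hs : 0 < 1 - s := by linarith
  have habs : |Real.Gamma (-s)| = Real.Gamma (2 - s) / ((1 - s) * s) := by
    have : Real.Gamma (-s) = -(Real.Gamma (2 - s) / ((1 - s) * s)) := by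
      rw [hΓ₂, hΓ₁]
      field_simp
    rw [this, abs_neg, abs_of_pos (by positivity)]
  have : 0 < Real.pi ^ ((n : ℝ) / 2) := Real.rpow_pos_of_pos Real.pi_pos _
  rw [fracConst, habs]
  field_simp

theorem volume_real_unitBall (hn : 1 ≤ n) :
    (volume : Measure (Eucl n)).real (ball 0 1) =
      Real.pi ^ ((n : ℝ) / 2) / Real.Gamma ((n : ℝ) / 2 + 1) := by
  have : Nonempty (Fin n) := ⟨⟨0, hn⟩⟩
  have : 0 < Real.Gamma ((n : ℝ) / 2 + 1) := Real.Gamma_pos_of_pos (by positivity)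
  rw [Measure.real, EuclideanSpace.volume_ball]
  simp only [ENNReal.ofReal_one, one_pow, one_mul, Fintype.card_fin]
  rw [ENNReal.toReal_ofReal (by positivity), Real.sqrt_eq_rpow, ← Real.rpow_natCast,
    ← Real.rpow_mul Real.pi_pos.le, one_div_mul_eq_div]

theorem tendsto_fracConst_div (hn : 1 ≤ n) :
    Tendsto (fun s => fracConst n s / (1 - s)) (𝓝[<] 1)
      (𝓝 (4 / (volume : Measure (Eucl n)).real (ball 0 1))) := by
  have hpi : 0 < Real.pi ^ ((n : ℝ) / 2) := Real.rpow_pos_of_pos Real.pi_pos _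
  have hΓ : ∀ x : ℝ, 0 < x → ContinuousAt Real.Gamma x := fun x hx =>
    (Real.differentiableAt_Gamma fun m => by
      have : (0 : ℝ) ≤ m := m.cast_nonneg
      linarith).continuousAt
  have hΓn : ContinuousAt (fun s : ℝ => Real.Gamma ((n : ℝ) / 2 + s)) 1 :=
    ContinuousAt.comp (f := fun s : ℝ => (n : ℝ) / 2 + s) (hΓ _ (by positivity)) (by fun_prop)
  have hΓ₂ : ContinuousAt (fun s : ℝ => Real.Gamma (2 - s)) 1 :=
    ContinuousAt.comp (f := fun s : ℝ => 2 - s) (hΓ _ (by norm_num)) (by fun_prop)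
  have hcont : ContinuousAt (fun s : ℝ => s * (4 : ℝ) ^ s * Real.Gamma ((n : ℝ) / 2 + s) /
      (Real.pi ^ ((n : ℝ) / 2) * Real.Gamma (2 - s))) 1 :=
    ((continuousAt_id.mul (Real.continuousAt_const_rpow (by norm_num))).mul hΓn).div
      (continuousAt_const.mul hΓ₂) (by norm_num [hpi.ne'])
  have hval : 1 * (4 : ℝ) ^ (1 : ℝ) * Real.Gamma ((n : ℝ) / 2 + 1) /
      (Real.pi ^ ((n : ℝ) / 2) * Real.Gamma (2 - 1)) =
        4 / (volume : Measure (Eucl n)).real (ball 0 1) := by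
    rw [volume_real_unitBall hn]
    norm_num
    field_simp
  rw [← hval]
  refine (hcont.tendsto.mono_left nhdsWithin_le_nhds).congr' ?_
  filter_upwards [Ioo_mem_nhdsLT (zero_lt_one' ℝ)] with s hs
  rw [fracConst_eq hs.1 hs.2, mul_div_cancel_left₀ _ (sub_ne_zero.2 hs.2.ne')]

/-- The profile of the radial kernel of the bilinear form: half the kernel of the fractional
Laplacian. -/
def fracKernel (n : ℕ) (s r : ℝ) : ℝ :=
  fracConst n s / 2 * r ^ (-((n : ℝ) + 2 * s))

theorem pow_finrank_mul_fracKernel (hn : 1 ≤ n) (s y : ℝ) (hy : 0 < y) :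
    y ^ (Module.finrank ℝ (Eucl n) - 1) * fracKernel n s y =
      fracConst n s / 2 * y ^ (-1 - 2 * s) := by
  have hexp : ((n - 1 : ℕ) : ℝ) + -((n : ℝ) + 2 * s) = -1 - 2 * s := by
    push_cast [Nat.cast_sub hn]
    ring
  rw [finrank_euclideanSpace_fin, fracKernel, mul_left_comm, ← Real.rpow_natCast,
    ← Real.rpow_add hy, hexp]

theorem pow_finrank_mul_fracKernel_mul_sq (hn : 1 ≤ n) (s y : ℝ) (hy : 0 < y) :
    y ^ (Module.finrank ℝ (Eucl n) - 1) * (fracKernel n s y * y ^ 2) =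
      fracConst n s / 2 * y ^ (1 - 2 * s) := by
  rw [← mul_assoc, pow_finrank_mul_fracKernel hn s y hy, mul_assoc, ← Real.rpow_natCast,
    ← Real.rpow_add hy]
  congr 2
  push_cast
  ring

theorem nontrivial_eucl (hn : 1 ≤ n) : Nontrivial (Eucl n) :=
  Module.nontrivial_of_finrank_pos (R := ℝ) (finrank_euclideanSpace_fin (𝕜 := ℝ) ▸ hn)

theorem isLevyKernel_fracKernel (hn : 1 ≤ n) {s : ℝ} (hs₀ : 0 < s) (hs₁ : s < 1) :
    IsLevyKernel (Eucl n) (fracKernel n s) where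
  measurable := by unfold fracKernel; fun_prop
  nonneg r hr := by
    have := fracConst_nonneg (n := n) hs₀
    unfold fracKernel
    positivity
  integrableOn_ball := by
    have := nontrivial_eucl hn
    exact integrableOn_ball_norm_of_rpow volume (pow_finrank_mul_fracKernel_mul_sq hn s)
      (by linarith) one_pos
  integrableOn_compl_ball δ hδ := by
    have := nontrivial_eucl hn
    exact integrableOn_compl_ball_norm_of_rpow volume (pow_finrank_mul_fracKernel hn s)
      (by linarith) hδ

theorem tendsto_setIntegral_ball_fracKernel (hn : 1 ≤ n) :
    Tendsto (fun s => ∫ h in ball (0 : Eucl n) 1, fracKernel n s ‖h‖ * ‖h‖ ^ 2) (𝓝[<] 1)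
      (𝓝 n) := by
  have := nontrivial_eucl hn
  have hvol : (volume : Measure (Eucl n)).real (ball 0 1) ≠ 0 :=
    (ENNReal.toReal_pos (measure_ball_pos volume _ one_pos).ne' measure_ball_lt_top.ne).ne'
  have hlim := (tendsto_fracConst_div hn).mul_const
    (n * (volume : Measure (Eucl n)).real (ball 0 1) / 4)
  rw [div_mul_div_comm, mul_comm _ (4 : ℝ), mul_div_mul_left _ _ four_ne_zero,
    mul_div_cancel_right₀ _ hvol] at hlim
  refine hlim.congr' ?_
  filter_upwards [self_mem_nhdsWithin] with s (hs : s < 1)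
  have hs' : 1 - s ≠ 0 := by linarith
  rw [setIntegral_ball_norm_of_rpow volume (pow_finrank_mul_fracKernel_mul_sq hn s)
    (by linarith) one_pos, finrank_euclideanSpace_fin, Real.one_rpow]
  have : 1 - 2 * s + 1 = 2 * (1 - s) := by ring
  rw [this]
  field_simp
  ring

theorem tendsto_setIntegral_compl_ball_fracKernel (hn : 1 ≤ n) {δ : ℝ} (hδ : 0 < δ) :
    Tendsto (fun s => ∫ h in (ball (0 : Eucl n) δ)ᶜ, fracKernel n s ‖h‖) (𝓝[<] 1) (𝓝 0) := by
  have := nontrivial_eucl hn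
  have hδs : ContinuousAt (fun s : ℝ => (1 - s) * (δ ^ (-2 * s) / (4 * s))) 1 := by
    refine ContinuousAt.mul (by fun_prop) (ContinuousAt.div ?_ (by fun_prop) (by norm_num))
    exact ContinuousAt.comp (f := fun s : ℝ => -2 * s) (Real.continuousAt_const_rpow hδ.ne')
      (by fun_prop)
  have hlim := ((tendsto_fracConst_div hn).mul
    (hδs.tendsto.mono_left nhdsWithin_le_nhds)).const_mul
      (n * (volume : Measure (Eucl n)).real (ball 0 1))
  rw [sub_self, zero_mul, mul_zero, mul_zero] at hlim
  refine hlim.congr' ?_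
  filter_upwards [Ioo_mem_nhdsLT (zero_lt_one' ℝ)] with s hs
  have hs₀ : s ≠ 0 := hs.1.ne'
  have hs₁ : 1 - s ≠ 0 := by linarith [hs.2]
  rw [setIntegral_compl_ball_norm_of_rpow volume (pow_finrank_mul_fracKernel hn s)
    (by linarith [hs.1]) hδ, finrank_euclideanSpace_fin]
  have : -1 - 2 * s + 1 = -2 * s := by ring
  rw [this]
  field_simp
  ring

theorem isConcentrating_fracKernel (hn : 1 ≤ n) :
    IsConcentrating (Eucl n) (𝓝[<] 1) (fracKernel n) where
  eventually_isLevyKernel := by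
    filter_upwards [Ioo_mem_nhdsLT (zero_lt_one' ℝ)] with s hs
    exact isLevyKernel_fracKernel hn hs.1 hs.2
  tendsto_ball := by
    rw [finrank_euclideanSpace_fin]
    exact tendsto_setIntegral_ball_fracKernel hn
  tendsto_compl_ball _ hδ := tendsto_setIntegral_compl_ball_fracKernel hn hδ

end FracKernel

section Increment

open Asymptotics

variable {E : Type*} [NormedAddCommGroup E] [InnerProductSpace ℝ E] [FiniteDimensional ℝ E]
  [MeasurableSpace E] [BorelSpace E]

/-- The density at `x` of the bilinear form in the increments of `u` and `v` in the direction `h`,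
weighted by `a` at both endpoints of the increment. -/
def incrementProduct (a u v : E → ℝ) (h x : E) : ℝ :=
  a x * a (x + h) * ((u (x + h) - u x) * (v (x + h) - v x))

theorem quasiMeasurePreserving_add :
    Measure.QuasiMeasurePreserving (fun z : E × E => z.1 + z.2) (volume.prod volume) volume :=
  Measure.quasiMeasurePreserving_snd.comp
    (measurePreserving_prod_add (volume : Measure E) volume).quasiMeasurePreserving

theorem incrementProduct_congr_ae {a a' u u' v v' : E → ℝ} (ha : a =ᵐ[volume] a')
    (hu : u =ᵐ[volume] u') (hv : v =ᵐ[volume] v') :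
    (fun z : E × E => incrementProduct a u v z.2 z.1) =ᵐ[volume.prod volume]
      fun z => incrementProduct a' u' v' z.2 z.1 := by
  have hfst := (Measure.quasiMeasurePreserving_fst (μ := (volume : Measure E))
    (ν := (volume : Measure E))).ae (ha.and (hu.and hv))
  filter_upwards [hfst, quasiMeasurePreserving_add.ae (ha.and (hu.and hv))]
    with z ⟨ha₁, hu₁, hv₁⟩ ⟨ha₂, hu₂, hv₂⟩
  simp only [incrementProduct, ha₁, hu₁, hv₁, ha₂, hu₂, hv₂]

theorem aestronglyMeasurable_incrementProduct {a u v : E → ℝ}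
    (ha : AEStronglyMeasurable a) (hu : AEStronglyMeasurable u) (hv : AEStronglyMeasurable v) :
    AEStronglyMeasurable (fun z : E × E => incrementProduct a u v z.2 z.1)
      (volume.prod volume) := by
  have hadd : ∀ {f : E → ℝ}, AEStronglyMeasurable f →
      AEStronglyMeasurable (fun z : E × E => f (z.1 + z.2)) (volume.prod volume) :=
    fun hf => hf.comp_quasiMeasurePreserving quasiMeasurePreserving_add
  exact (ha.comp_fst.mul (hadd ha)).mul
    (((hadd hu).sub hu.comp_fst).mul ((hadd hv).sub hv.comp_fst))

theorem integral_norm_mul_le {α : Type*} [MeasurableSpace α] {μ : Measure α} (f g : Lp ℝ 2 μ) :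
    ∫ x, ‖f x * g x‖ ∂μ ≤ ‖f‖ * ‖g‖ := by
  have hinner : ∫ x, ‖f x * g x‖ ∂μ = inner ℝ |f| |g| := by
    rw [L2.inner_def]
    refine integral_congr_ae ?_
    filter_upwards [Lp.coeFn_abs f, Lp.coeFn_abs g] with x hf hg
    rw [hf, hg, RCLike.inner_apply, conj_trivial, norm_mul, mul_comm]
    rfl
  rw [hinner]
  exact (real_inner_le_norm _ _).trans_eq (by rw [norm_abs_eq_norm, norm_abs_eq_norm])

variable (a : Lp ℝ ⊤ (volume : Measure E)) (u v : Lp ℝ 2 (volume : Measure E)) (h : E)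

theorem coeFn_smul_translate_sub (b : Lp ℝ ⊤ (volume : Measure E)) :
    (b • (translate h u - u) : Lp ℝ 2 volume) =ᵐ[volume] fun x => b x * (u (x + h) - u x) := by
  filter_upwards [Lp.coeFn_lpSMul (r := 2) b (translate h u - u), Lp.coeFn_sub (translate h u) u,
    coeFn_translate h u] with x h₁ h₂ h₃
  rw [h₁, Pi.smul_apply', h₂, Pi.sub_apply, h₃, smul_eq_mul]

theorem incrementProduct_ae_eq_mul :
    incrementProduct a u v h =ᵐ[volume] fun x => (a • (translate h u - u) : Lp ℝ 2 volume) x *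
      (translate h a • (translate h v - v) : Lp ℝ 2 volume) x := by
  filter_upwards [coeFn_smul_translate_sub u h a, coeFn_smul_translate_sub v h (translate h a),
    coeFn_translate h a] with x h₁ h₂ h₃
  rw [h₁, h₂, h₃, incrementProduct]
  ring

theorem integrable_incrementProduct : Integrable (incrementProduct a u v h) :=
  ((Lp.memLp _).integrable_mul (Lp.memLp _)).congr (incrementProduct_ae_eq_mul a u v h).symm

theorem integral_incrementProduct :
    ∫ x, incrementProduct a u v h x = inner ℝ (a • (translate h u - u) : Lp ℝ 2 volume)
      (translate h a • (translate h v - v) : Lp ℝ 2 volume) := by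
  rw [integral_congr_ae (incrementProduct_ae_eq_mul a u v h), L2.inner_def]
  refine integral_congr_ae (.of_forall fun x => ?_)
  dsimp only
  rw [RCLike.inner_apply, conj_trivial, mul_comm]

theorem integral_norm_incrementProduct_le :
    ∫ x, ‖incrementProduct a u v h x‖ ≤
      ‖a‖ * ‖translate h u - u‖ * (‖a‖ * ‖translate h v - v‖) := by
  calc ∫ x, ‖incrementProduct a u v h x‖
      = ∫ x, ‖(a • (translate h u - u) : Lp ℝ 2 volume) x *
          (translate h a • (translate h v - v) : Lp ℝ 2 volume) x‖ :=
        integral_congr_ae ((incrementProduct_ae_eq_mul a u v h).fun_comp norm)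
    _ ≤ ‖(a • (translate h u - u) : Lp ℝ 2 volume)‖ *
        ‖(translate h a • (translate h v - v) : Lp ℝ 2 volume)‖ := integral_norm_mul_le _ _
    _ ≤ ‖a‖ * ‖translate h u - u‖ * (‖translate h a‖ * ‖translate h v - v‖) := by
        gcongr <;> exact Lp.norm_smul_le _ _
    _ = _ := by rw [LinearIsometry.norm_map]

theorem norm_translate_sub_le : ‖translate h u - u‖ ≤ 2 * ‖u‖ := by
  refine (norm_sub_le _ _).trans_eq ?_
  rw [LinearIsometry.norm_map, two_mul]

theorem integral_norm_incrementProduct_le_norm :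
    ∫ x, ‖incrementProduct a u v h x‖ ≤ ‖a‖ * (2 * ‖u‖) * (‖a‖ * (2 * ‖v‖)) :=
  (integral_norm_incrementProduct_le a u v h).trans
    (by gcongr <;> exact norm_translate_sub_le _ h)

variable {a u v} {G H : Lp E 2 (volume : Measure E)}

theorem isBigO_integral_norm_incrementProduct
    (hu : HasFDerivAt (fun h => translate h u) (directional G) 0)
    (hv : HasFDerivAt (fun h => translate h v) (directional H) 0) :
    (fun h => ∫ x, ‖incrementProduct a u v h x‖) =O[𝓝 0] fun h => ‖h‖ ^ 2 := by
  have hincr : ∀ {w : Lp ℝ 2 (volume : Measure E)} {K : Lp E 2 (volume : Measure E)},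
      HasFDerivAt (fun h => translate h w) (directional K) 0 →
      (fun h => ‖a‖ * ‖translate h w - w‖) =O[𝓝 0] fun h => ‖h‖ := fun hw => by
    simpa only [translate_zero, sub_zero] using (hw.isBigO_sub.norm_norm.const_mul_left ‖a‖)
  refine IsBigO.trans (IsBigO.of_norm_le fun h => ?_)
    (by simpa only [sq] using (hincr hu).mul (hincr hv))
  rw [Real.norm_of_nonneg (integral_nonneg fun x => norm_nonneg _)]
  exact integral_norm_incrementProduct_le a u v h

theorem isLittleO_integral_incrementProduct_sub
    (hu : HasFDerivAt (fun h => translate h u) (directional G) 0)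
    (hv : HasFDerivAt (fun h => translate h v) (directional H) 0) :
    (fun h => (∫ x, incrementProduct a u v h x) -
        inner ℝ (directional (a • G : Lp E 2 volume) h) (directional (a • H : Lp E 2 volume) h))
      =o[𝓝 0] fun h => ‖h‖ ^ 2 := by
  have hzero : ∀ w : Lp ℝ 2 (volume : Measure E), translate 0 w - w = 0 := fun w => by
    rw [translate_zero, sub_self]
  have hP := hasFDerivAt_smul_of_tendsto (hu.sub_const u) (hzero u) (A := fun _ => a)
    (fun _ => le_rfl) tendsto_const_nhds
  have hR := hasFDerivAt_smul_of_tendsto (hv.sub_const v) (hzero v) (A := fun h => translate h a)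
    (fun h => (LinearIsometry.norm_map _ a).le) (tendsto_translate_smul ENNReal.ofNat_ne_top a H)
  simp only [integral_incrementProduct]
  exact isLittleO_inner_sub_inner_fderiv hP (by rw [hzero, Lp.smul_zero]) hR
    (by rw [hzero, Lp.smul_zero])

theorem IsLevyKernel.integrable_mul_incrementProduct {k : ℝ → ℝ} (hk : IsLevyKernel E k)
    (hu : HasFDerivAt (fun h => translate h u) (directional G) 0)
    (hv : HasFDerivAt (fun h => translate h v) (directional H) 0) :
    Integrable (fun z : E × E => k ‖z.2‖ * incrementProduct a u v z.2 z.1)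
      (volume.prod volume) := by
  have hm := aestronglyMeasurable_incrementProduct (Lp.aestronglyMeasurable a)
    (Lp.aestronglyMeasurable u) (Lp.aestronglyMeasurable v)
  have hkm : AEStronglyMeasurable (fun z : E × E => k ‖z.2‖) (volume.prod volume) :=
    (hk.measurable.comp (measurable_norm.comp measurable_snd)).aestronglyMeasurable
  have hF := hk.integrable_mul (F := fun h => ∫ x, ‖incrementProduct a u v h x‖)
    hm.prod_swap.norm.integral_prod_right'
    (fun h => (abs_of_nonneg (integral_nonneg fun x => norm_nonneg _)).trans_le
      (integral_norm_incrementProduct_le_norm a u v h))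
    (isBigO_integral_norm_incrementProduct hu hv)
  have hmul : AEStronglyMeasurable
      (fun z : E × E => k ‖z.2‖ * incrementProduct a u v z.2 z.1) (volume.prod volume) :=
    hkm.mul hm
  refine (integrable_prod_iff' hmul).2
    ⟨.of_forall fun h => (integrable_incrementProduct a u v h).const_mul (k ‖h‖), ?_⟩
  simpa only [norm_mul, integral_const_mul, Real.norm_of_nonneg (hk.nonneg _ (norm_nonneg _))]
    using hF

theorem IsConcentrating.tendsto_integral_mul_incrementProduct [Nontrivial E] {ι : Type*}
    {l : Filter ι} {k : ι → ℝ → ℝ} (hk : IsConcentrating E l k)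
    (hu : HasFDerivAt (fun h => translate h u) (directional G) 0)
    (hv : HasFDerivAt (fun h => translate h v) (directional H) 0) :
    Tendsto (fun i => ∫ h, k i ‖h‖ * ∫ x, incrementProduct a u v h x) l
      (𝓝 (inner ℝ (a • G : Lp E 2 volume) (a • H : Lp E 2 volume))) := by
  let B : E →L[ℝ] E →L[ℝ] ℝ := (innerSL ℝ).bilinearComp (directional (a • G : Lp E 2 volume))
    (directional (a • H : Lp E 2 volume))
  have hm := aestronglyMeasurable_incrementProduct (Lp.aestronglyMeasurable a)
    (Lp.aestronglyMeasurable u) (Lp.aestronglyMeasurable v)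
  rw [← sum_inner_directional (stdOrthonormalBasis ℝ E)]
  exact hk.tendsto_integral_mul (g := fun h => ∫ x, incrementProduct a u v h x) (B := B)
    hm.prod_swap.integral_prod_right'
    (fun h => (norm_integral_le_integral_norm _).trans
      (integral_norm_incrementProduct_le_norm a u v h))
    (isLittleO_integral_incrementProduct_sub hu hv) (stdOrthonormalBasis ℝ E)

end Increment

section Conductivity

variable {α : Type*} [MeasurableSpace α] {μ : Measure α} {γ : α → ℝ}

theorem memLp_top_sqrt {c : ℝ} (hγ : AEMeasurable γ μ) (hγc : ∀ᵐ x ∂μ, γ x ≤ c) :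
    MemLp (fun x => √(γ x)) ⊤ μ :=
  memLp_top_of_bound hγ.sqrt.aestronglyMeasurable (√c) <| hγc.mono fun x hx => by
    rw [Real.norm_of_nonneg (Real.sqrt_nonneg _)]
    exact Real.sqrt_le_sqrt hx

theorem inner_smul_smul_ae_eq {F : Type*} [NormedAddCommGroup F] [InnerProductSpace ℝ F]
    {a : Lp ℝ ⊤ μ} {G H : Lp F 2 μ} {g h : α → F} (hγ : ∀ᵐ x ∂μ, 0 ≤ γ x)
    (ha : a =ᵐ[μ] fun x => √(γ x)) (hG : G =ᵐ[μ] g) (hH : H =ᵐ[μ] h) :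
    (fun x => inner ℝ ((a • G : Lp F 2 μ) x) ((a • H : Lp F 2 μ) x)) =ᵐ[μ]
      fun x => γ x * inner ℝ (g x) (h x) := by
  filter_upwards [Lp.coeFn_lpSMul (r := 2) a G, Lp.coeFn_lpSMul (r := 2) a H, hγ, ha, hG, hH]
    with x haG haH hγx hax hGx hHx
  rw [haG, haH, Pi.smul_apply', Pi.smul_apply', hax, hGx, hHx, real_inner_smul_left,
    real_inner_smul_right, ← mul_assoc, Real.mul_self_sqrt hγx]

end Conductivity

section BilinearForm

variable {n : ℕ}

theorem HasWeakGradient.congr {u u' : Eucl n → ℝ} {G G' : Eucl n → Eucl n}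
    (hw : HasWeakGradient u G) (hu : u' =ᵐ[volume] u) (hG : G' =ᵐ[volume] G) :
    HasWeakGradient u' G' where
  locallyIntegrable := (locallyIntegrable_congr hu).2 hw.locallyIntegrable
  locallyIntegrable_grad := (locallyIntegrable_congr hG).2 hw.locallyIntegrable_grad
  integral_eq φ hφ hφc e := by
    rw [integral_congr_ae (g := fun x => u x * fderiv ℝ φ x e)
      (hu.mono fun x hx => by simp only [hx]), hw.integral_eq φ hφ hφc e,
      integral_congr_ae (g := fun x => φ x * inner ℝ (G' x) e)
      (hG.mono fun x hx => by simp only [hx])]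

theorem HasWeakGradient.ae_eq {u : Eucl n → ℝ} {G G' : Eucl n → Eucl n}
    (h : HasWeakGradient u G) (h' : HasWeakGradient u G') : G =ᵐ[volume] G' := by
  refine ae_eq_of_integral_contDiff_smul_eq h.locallyIntegrable_grad h'.locallyIntegrable_grad ?_
  intro φ hφ hφc
  have hinner : ∀ {K : Eucl n → Eucl n} (e : Eucl n), HasWeakGradient u K →
      inner ℝ (∫ x, φ x • K x) e = -∫ x, u x * fderiv ℝ φ x e := fun {K} e hK => by
    have hint := hK.locallyIntegrable_grad.integrable_smul_left_of_hasCompactSupport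
      hφ.continuous hφc
    rw [hK.integral_eq φ hφ hφc e, neg_neg, real_inner_comm, ← integral_inner hint]
    simp only [real_inner_comm, real_inner_smul_right]
  exact ext_inner_right ℝ fun e => (hinner e h).trans (hinner e h').symm

theorem MemH1.memLp_of_hasWeakGradient {u : Eucl n → ℝ} {G : Eucl n → Eucl n} (hu : MemH1 u)
    (hw : HasWeakGradient u G) : MemLp G 2 volume := by
  obtain ⟨_, G', hG', hw'⟩ := hu
  exact hG'.ae_eq (hw'.ae_eq hw)

theorem MemH1.hasFDerivAt_translate {u : Eucl n → ℝ} {G : Eucl n → Eucl n} (hu : MemH1 u)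
    (hw : HasWeakGradient u G) :
    HasFDerivAt (fun h => translate h (hu.1.toLp u))
      (directional ((hu.memLp_of_hasWeakGradient hw).toLp G)) 0 :=
  HasWeakGradient.hasFDerivAt_translate (hw.congr hu.1.coeFn_toLp (MemLp.coeFn_toLp _))

theorem bilinIntegrand_add_right {s : ℝ} (hs : 0 < s) (γ u v : Eucl n → ℝ) (x h : Eucl n) :
    bilinIntegrand s γ u v x (x + h) =
      fracKernel n s ‖h‖ * incrementProduct (fun x => √(γ x)) u v h x := by
  rcases eq_or_ne h 0 with rfl | hh
  · simp [bilinIntegrand, fracGradient, incrementProduct]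
  have hp : 0 < ‖h‖ := norm_pos_iff.2 hh
  have hpow : ‖h‖ ^ (-((n : ℝ) + 2 * s)) = ‖h‖ ^ 2 / (‖h‖ ^ ((n : ℝ) / 2 + s + 1)) ^ 2 := by
    rw [← Real.rpow_natCast _ 2, ← Real.rpow_natCast _ 2, ← Real.rpow_mul hp.le,
      ← Real.rpow_sub hp]
    congr 1
    push_cast
    ring
  have hconst : (√(fracConst n s) / √2) ^ 2 = fracConst n s / 2 := by
    rw [div_pow, Real.sq_sqrt (fracConst_nonneg hs), Real.sq_sqrt (by norm_num)]
  simp only [bilinIntegrand, fracGradient, interaction, incrementProduct, fracKernel,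
    add_sub_cancel_left, smul_apply, ContinuousLinearMap.id_apply,
    real_inner_smul_left, real_inner_smul_right, real_inner_self_eq_norm_sq]
  rw [hpow, ← hconst]
  ring

variable {γ u v : Eucl n → ℝ} {s : ℝ}

theorem integrable_bilinIntegrand_iff :
    Integrable (fun p : Eucl n × Eucl n => bilinIntegrand s γ u v p.1 p.2)
        (volume.prod volume) ↔
      Integrable (fun p : Eucl n × Eucl n => bilinIntegrand s γ u v p.1 (p.1 + p.2))
        (volume.prod volume) :=
  ((measurePreserving_prod_add (volume : Measure (Eucl n)) volume).integrable_comp_emb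
    (MeasurableEquiv.shearAddRight (Eucl n)).measurableEmbedding).symm

theorem bilin_eq_integral_integral_add_right :
    bilin s γ u v = ∫ x, ∫ h, bilinIntegrand s γ u v x (x + h) :=
  integral_congr_ae <| .of_forall fun x =>
    (integral_add_left_eq_self (fun y => bilinIntegrand s γ u v x y) x).symm

variable {a : Lp ℝ ⊤ (volume : Measure (Eucl n))} {U V : Lp ℝ 2 (volume : Measure (Eucl n))}

theorem bilinIntegrand_add_right_ae_eq (hs : 0 < s) (ha : a =ᵐ[volume] fun x => √(γ x))
    (hU : U =ᵐ[volume] u) (hV : V =ᵐ[volume] v) :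
    (fun p : Eucl n × Eucl n => bilinIntegrand s γ u v p.1 (p.1 + p.2)) =ᵐ[volume.prod volume]
      fun p => fracKernel n s ‖p.2‖ * incrementProduct a U V p.2 p.1 := by
  filter_upwards [incrementProduct_congr_ae ha hU hV] with p hp
  rw [bilinIntegrand_add_right hs, hp]

theorem bilin_eq_integral_fracKernel_mul (hs : 0 < s) (ha : a =ᵐ[volume] fun x => √(γ x))
    (hU : U =ᵐ[volume] u) (hV : V =ᵐ[volume] v)
    (hint : Integrable
      (fun p : Eucl n × Eucl n => fracKernel n s ‖p.2‖ * incrementProduct a U V p.2 p.1)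
      (volume.prod volume)) :
    bilin s γ u v = ∫ h, fracKernel n s ‖h‖ * ∫ x, incrementProduct a U V h x := by
  have hae := bilinIntegrand_add_right_ae_eq hs ha hU hV
  calc bilin s γ u v = ∫ x, ∫ h, bilinIntegrand s γ u v x (x + h) :=
        bilin_eq_integral_integral_add_right
    _ = ∫ p : Eucl n × Eucl n, fracKernel n s ‖p.2‖ * incrementProduct a U V p.2 p.1
          ∂(volume.prod volume) := by
        rw [← integral_congr_ae hae, integral_prod _ (hint.congr hae.symm)]
    _ = ∫ h, ∫ x, fracKernel n s ‖h‖ * incrementProduct a U V h x := integral_prod_symm _ hint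
    _ = _ := by simp only [integral_const_mul]

end BilinearForm

end FracCond

end

open FracCond in
theorem lemma4p3_general (n : ℕ) (hn : 1 ≤ n) (γ : Eucl n → ℝ) (hγ : AEMeasurable γ)
    (γup : ℝ) (hbound : ∀ᵐ x, 0 ≤ γ x ∧ γ x ≤ γup)
    (u v : Eucl n → ℝ) (hu : MemH1 u) (hv : MemH1 v) (gradu gradv : Eucl n → Eucl n)
    (hgradu : HasWeakGradient u gradu) (hgradv : HasWeakGradient v gradv) :
    (∀ s : ℝ, 0 < s → s < 1 →
      Integrable (fun p : Eucl n × Eucl n => bilinIntegrand s γ u v p.1 p.2)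
        (volume.prod volume)) ∧
    Integrable (fun x => γ x * inner ℝ (gradu x) (gradv x)) volume ∧
    Tendsto (fun s : ℝ => bilin s γ u v) (𝓝[<] 1)
      (𝓝 (∫ x, γ x * inner ℝ (gradu x) (gradv x))) := by
  have := nontrivial_eucl hn
  have ha := memLp_top_sqrt hγ (hbound.mono fun x hx => hx.2)
  have hdu := hu.hasFDerivAt_translate hgradu
  have hdv := hv.hasFDerivAt_translate hgradv
  have hint := fun (s : ℝ) (hs₀ : 0 < s) (hs₁ : s < 1) => (isLevyKernel_fracKernel
    hn hs₀ hs₁).integrable_mul_incrementProduct (a := ha.toLp _) hdu hdv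
  have hgrad := inner_smul_smul_ae_eq (hbound.mono fun x hx => hx.1) ha.coeFn_toLp
    (hu.memLp_of_hasWeakGradient hgradu).coeFn_toLp
    (hv.memLp_of_hasWeakGradient hgradv).coeFn_toLp
  refine ⟨fun s hs₀ hs₁ => integrable_bilinIntegrand_iff.2 <| (hint s hs₀ hs₁).congr
    (bilinIntegrand_add_right_ae_eq hs₀ ha.coeFn_toLp hu.1.coeFn_toLp hv.1.coeFn_toLp).symm,
    (L2.integrable_inner _ _).congr hgrad, ?_⟩
  rw [← integral_congr_ae hgrad, ← L2.inner_def]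
  refine ((isConcentrating_fracKernel hn).tendsto_integral_mul_incrementProduct hdu hdv).congr' ?_
  filter_upwards [Ioo_mem_nhdsLT (zero_lt_one' ℝ)] with s hs
  exact (bilin_eq_integral_fracKernel_mul hs.1 ha.coeFn_toLp hu.1.coeFn_toLp hv.1.coeFn_toLp
    (hint s hs.1 hs.2)).symm

theorem lemma4p3 (n : ℕ) (hn : 1 ≤ n)
    (γ : FracCond.Eucl n → ℝ) (hγ : Measurable γ)
    (γlow γup : ℝ) (hlow : 0 < γlow) (hbound : ∀ᵐ x, γlow ≤ γ x ∧ γ x ≤ γup)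
    (u v : FracCond.Eucl n → ℝ) (hu : FracCond.MemH1 u) (hv : FracCond.MemH1 v)
    (gradu gradv : FracCond.Eucl n → FracCond.Eucl n)
    (hgradu : FracCond.HasWeakGradient u gradu) (hgradv : FracCond.HasWeakGradient v gradv) :
    (∀ s : ℝ, 0 < s → s < 1 →
      Integrable (fun p : FracCond.Eucl n × FracCond.Eucl n =>
        FracCond.bilinIntegrand s γ u v p.1 p.2) (volume.prod volume)) ∧
    Integrable (fun x => γ x * inner ℝ (gradu x) (gradv x)) volume ∧
    Tendsto (fun s : ℝ => FracCond.bilin s γ u v) (𝓝[<] 1)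
      (𝓝 (∫ x, γ x * inner ℝ (gradu x) (gradv x))) :=
  lemma4p3_general n hn γ hγ.aemeasurable γup
    (hbound.mono fun _ hx => ⟨hlow.le.trans hx.1, hx.2⟩) u v hu hv gradu gradv hgradu hgradv
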